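/- Let $n \ge 0$, let $X \subset \mathbb{R}^n$ be compact and convex, and let $S \subset \mathbb{R}^n$ be non-empty, closed and bounded (not necessarily convex). Put $\ell_S(x,y) = \sup_{s \in S} s\cdot(x-y)$. Let $U(X,S)$ be the set of convex functions $u : X \to \mathbb{R}$ that have a subgradient in $S$ at every point of $X$, i.e. for every $x \in X$ there is $s \in S$ with $u(y) \ge u(x) + s\cdot(y-x)$ for all $y \in X$. Let $U^\circ(X,S) = \{\lambda u : \lambda \ge 0,\ u \in U(X,S)\}$, and let $\mathrm{cl}(\mathrm{conv}(U^\circ(X,S)))$ be the closure of its convex hull in $C(X)$ with the supremum norm. For finite positive Borel measures $\nu',\nu$ on $X$ write $\nu' \succeq_{X,S} \nu$ if $\int_X u\,d\nu' \ge \int_X u\,d\nu$ for all $u \in U(X,S)$. Let $\mu$ be a (finite) signed Radon measure on $X$ with $\mu(X) = 0$ and Jordan decomposition $\mu = \mu_+ - \mu_-$. For a measure $\gamma$ on $X \times X$ let $\gamma_1,\gamma_2$ denote its first and second marginals. Then $$\sup_{\substack{\phi,\psi \in \mathrm{cl}(\mathrm{conv}(U^\circ(X,S)))\\ \phi(x)-\psi(y)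 \le \ell_S(x,y)\ \forall x,y \in X}} \left(\int_X \phi\, d\mu_+ - \int_X \psi\, d\mu_-\right) = \min_{\substack{\gamma \in \mathrm{Radon}_+(X \times X)\\ \gamma_1 \succeq_{X,S} \mu_+\\ \mu_- \succeq_{X,S} \gamma_2}} \int_{X \times X} \ell_S(x,y)\, d\gamma(x,y),$$ where $\mathrm{Radon}_+(X\times X)$ is the set of finite positive Radon measures on $X \times X$; both sides are finite and the minimum on the right is attained. -/

import Mathlib

open MeasureTheory

namespace RestrictedAuction

/-- `ℝⁿ`, the space of types and of allocations; `s · x` is `inner ℝ s x`. -/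
abbrev Vec (n : ℕ) : Type := EuclideanSpace ℝ (Fin n)

/-- `s` is a subgradient at `x ∈ X` of the function `u` on `X`. -/
def IsSubgradientAt {n : ℕ} {X : Set (Vec n)} (u : X → ℝ) (x : X) (s : Vec n) : Prop :=
  ∀ y : X, u x + inner ℝ s ((y : Vec n) - (x : Vec n)) ≤ u y

/-- `U(X,S)`: the convex functions on `X` that have, at every point of `X`, a subgradient
belonging to `S`. (For bounded `S` such functions are Lipschitz, so that asking for elements of
`C(X, ℝ)` is no restriction. `Function.extend` only extends `u` by zero outside `X`, and
`ConvexOn ℝ X` does not look at these values.) -/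
def feasibleUtilities {n : ℕ} (X S : Set (Vec n)) : Set C(X, ℝ) :=
  {u | ConvexOn ℝ X (Function.extend ((↑) : X → Vec n) u 0) ∧
    ∀ x : X, ∃ s ∈ S, IsSubgradientAt u x s}

/-- The cone `U° = {λ u | λ ≥ 0, u ∈ U}` generated by a set `U` of functions. -/
def generatedCone {n : ℕ} {X : Set (Vec n)} (U : Set C(X, ℝ)) : Set C(X, ℝ) :=
  {f | ∃ c : ℝ, 0 ≤ c ∧ ∃ u ∈ U, f = c • u}

/-- `cl(conv(U°(X,S)))`. For compact `X` the topology of `C(X, ℝ)` is that of uniform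
convergence. -/
def utilityCone {n : ℕ} (X S : Set (Vec n)) : Set C(X, ℝ) :=
  closure (convexHull ℝ (generatedCone (feasibleUtilities X S)))

/-- `ℓ_S(x,y) = sup_{s ∈ S} s · (x - y)`. -/
noncomputable def supportGap {n : ℕ} (S : Set (Vec n)) (x y : Vec n) : ℝ :=
  sSup ((fun s : Vec n => inner ℝ s (x - y)) '' S)

/-- The integral stochastic order `ν' ⪰_{X,S} ν`, for finite Borel measures on `X`. -/
def Dominates {n : ℕ} {X : Set (Vec n)} (S : Set (Vec n)) (ν' ν : Measure X) : Prop :=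
  ∀ u ∈ feasibleUtilities X S, ∫ x, u x ∂ν ≤ ∫ x, u x ∂ν'

/-- The positive part `μ₊` of the Jordan decomposition of `μ`. -/
noncomputable def posPart {n : ℕ} {X : Set (Vec n)} (μ : SignedMeasure X) : Measure X :=
  μ.toJordanDecomposition.posPart

/-- The negative part `μ₋` of the Jordan decomposition of `μ`. -/
noncomputable def negPart {n : ℕ} {X : Set (Vec n)} (μ : SignedMeasure X) : Measure X :=
  μ.toJordanDecomposition.negPart

/-- The values `∫ φ dμ₊ - ∫ ψ dμ₋` of the pairs `φ, ψ ∈ cl(conv(U°(X,S)))` with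
`φ(x) - ψ(y) ≤ ℓ_S(x,y)` for all `x, y ∈ X`. -/
def primalValues {n : ℕ} {X : Set (Vec n)} (S : Set (Vec n)) (μ : SignedMeasure X) : Set ℝ :=
  {r | ∃ φ ∈ utilityCone X S, ∃ ψ ∈ utilityCone X S,
    (∀ x y : X, φ x - ψ y ≤ supportGap S x y) ∧
    r = ∫ x, φ x ∂(posPart μ) - ∫ x, ψ x ∂(negPart μ)}

/-- The values `∫ ℓ_S dγ` of the finite positive Borel measures `γ` on `X × X` with
`γ₁ ⪰_{X,S} μ₊` and `μ₋ ⪰_{X,S} γ₂`. -/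
def dualValues {n : ℕ} {X : Set (Vec n)} (S : Set (Vec n)) (μ : SignedMeasure X) : Set ℝ :=
  {r | ∃ γ : Measure (X × X), IsFiniteMeasure γ ∧
    Dominates S γ.fst (posPart μ) ∧ Dominates S (negPart μ) γ.snd ∧
    r = ∫ p, supportGap S p.1 p.2 ∂γ}

end RestrictedAuction

namespace RestrictedAuction

/-! ### Riesz representation and Lagrange multipliers in `C(Y, ℝ)` -/

section Multiplier

variable {Y : Type*} [TopologicalSpace Y] [CompactSpace Y]

/-! This is linear programming duality over the convex cone `utilityCone X S`. Affine functions with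
slope in `S` give a Slater point, so Hahn–Banach yields a positive multiplier for the constraint `φ
x - ψ y ≤ ℓ_S(x, y)` (`exists_lagrange_multiplier`), which by Riesz is a measure `γ`. Since pairs in
the cone can be scaled by any `t ≥ 0`, the multiplier inequality splits into a homogeneous part, the
two dominance conditions on the marginals, and its value at zero, `∫ ℓ_S dγ ≤ v`. Weak duality gives
the reverse bound, so `γ` attains the minimum. Finiteness of the supremum `v` rests on `μ(X) = 0`
(`bddAbove_primalValues`). -/

theorem exists_measure_integral_eq [T2Space Y] [MeasurableSpace Y] [BorelSpace Y]
    (L : C(Y, ℝ) →ₗ[ℝ] ℝ) (hL : ∀ f : C(Y, ℝ), (∀ y, 0 ≤ f y) → 0 ≤ L f) :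
    ∃ γ : Measure Y, IsFiniteMeasure γ ∧ ∀ f : C(Y, ℝ), ∫ y, f y ∂γ = L f := by
  let toC : CompactlySupportedContinuousMap Y ℝ →ₗ[ℝ] C(Y, ℝ) :=
    { toFun := fun f => f.toContinuousMap
      map_add' := fun _ _ => rfl
      map_smul' := fun _ _ => rfl }
  let P : CompactlySupportedContinuousMap Y ℝ →ₚ[ℝ] ℝ :=
    PositiveLinearMap.mk₀ (L.comp toC) fun f hf => hL _ fun y => hf y
  refine ⟨RealRMK.rieszMeasure P, ?_, fun f => ?_⟩
  · have : IsFiniteMeasureOnCompacts (RealRMK.rieszMeasure P) := by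
      unfold RealRMK.rieszMeasure
      infer_instance
    exact ⟨isCompact_univ.measure_lt_top⟩
  · exact RealRMK.integral_rieszMeasure P (CompactlySupportedContinuousMap.continuousMapEquiv f)

theorem isOpen_setOf_forall_lt (g : C(Y, ℝ)) : IsOpen {h : C(Y, ℝ) | ∀ y, h y < g y} := by
  have h₁ : IsOpen {f : C(Y, ℝ) | Set.MapsTo f Set.univ (Set.Ioi 0)} :=
    ContinuousMap.isOpen_setOfPred_mapsTo isCompact_univ isOpen_Ioi
  have h₂ : Continuous fun h : C(Y, ℝ) => g - h := by fun_prop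
  convert h₁.preimage h₂ using 1
  ext h
  simp [Set.MapsTo]

theorem le_of_forall_pos_sub_mul_lt {a b d : ℝ} (h : ∀ ε > 0, a - ε * b < d) : a ≤ d := by
  by_contra! hd
  have hb : 0 < |b| + 1 := by positivity
  have h₁ := h ((a - d) / (|b| + 1)) (div_pos (sub_pos.2 hd) hb)
  have h₂ : (a - d) / (|b| + 1) * b ≤ (a - d) / (|b| + 1) * (|b| + 1) := by
    refine mul_le_mul_of_nonneg_left ?_ (div_pos (sub_pos.2 hd) hb).le
    linarith [le_abs_self b]
  rw [div_mul_cancel₀ _ hb.ne'] at h₂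
  linarith

/-- Existence of a Lagrange multiplier for a linear program over a convex set with constraints
`G e ≤ l` in `C(Y, ℝ)`, under Slater's condition. -/
theorem exists_lagrange_multiplier {E : Type*} [AddCommGroup E] [Module ℝ E] {K : Set E}
    (hK : Convex ℝ K) (G : E →ₗ[ℝ] C(Y, ℝ)) (J : E →ₗ[ℝ] ℝ) (l : C(Y, ℝ)) (v : ℝ)
    {e₀ : E} (he₀ : e₀ ∈ K) (hslater : ∀ y, G e₀ y < l y)
    (hv : ∀ e ∈ K, (∀ y, G e y ≤ l y) → J e ≤ v) :
    ∃ L : C(Y, ℝ) →ₗ[ℝ] ℝ, (∀ f : C(Y, ℝ), (∀ y, 0 ≤ f y) → 0 ≤ L f) ∧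
      ∀ e ∈ K, J e + L (l - G e) ≤ v := by
  -- Pairs strictly below (slack, value) of some `e ∈ K`. If `(0, v)` belonged to this set, a
  -- feasible `e` would have value above `v`; hence the two can be separated.
  let A : Set (C(Y, ℝ) × ℝ) :=
    {p | ∃ e ∈ K, (∀ y, p.1 y < (l - G e) y) ∧ p.2 < J e}
  have hAopen : IsOpen A := by
    have : A = ⋃ e ∈ K, {h : C(Y, ℝ) | ∀ y, h y < (l - G e) y} ×ˢ Set.Iio (J e) := by
      ext p
      simp only [A, Set.mem_ofPred_eq, Set.mem_iUnion, Set.mem_prod, Set.mem_Iio, exists_prop]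
    rw [this]
    exact isOpen_biUnion fun e _ => (isOpen_setOf_forall_lt _).prod isOpen_Iio
  have hAconvex : Convex ℝ A := by
    rintro p ⟨e, he, hp₁, hp₂⟩ q ⟨e', he', hq₁, hq₂⟩ a b ha hb hab
    refine ⟨a • e + b • e', hK he he' ha hb hab, fun y => ?_, ?_⟩
    · have h₁ := hp₁ y
      have h₂ := hq₁ y
      simp only [ContinuousMap.sub_apply, map_add, map_smul, ContinuousMap.add_apply,
        ContinuousMap.smul_apply, smul_eq_mul, Prod.fst_add, Prod.smul_fst] at h₁ h₂ ⊢
      have := (convex_Ioi (0 : ℝ)) (sub_pos.2 h₁) (sub_pos.2 h₂) ha hb hab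
      simp only [smul_eq_mul, Set.mem_Ioi] at this
      have hl : l y = a * l y + b * l y := by rw [← add_mul, hab, one_mul]
      linarith
    · have := (convex_Ioi (0 : ℝ)) (sub_pos.2 hp₂) (sub_pos.2 hq₂) ha hb hab
      simp only [smul_eq_mul, Set.mem_Ioi] at this
      simp only [map_add, map_smul, smul_eq_mul, Prod.snd_add, Prod.smul_snd]
      linarith
  have hnot : ((0 : C(Y, ℝ)), v) ∉ A := by
    rintro ⟨e, he, h₁, h₂⟩
    refine (hv e he fun y => ?_).not_gt h₂
    simpa using (h₁ y).le
  obtain ⟨F, hF⟩ := geometric_hahn_banach_open_point hAconvex hAopen hnot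
  let M : C(Y, ℝ) →ₗ[ℝ] ℝ := F.toLinearMap.comp (LinearMap.inl ℝ C(Y, ℝ) ℝ)
  let c : ℝ := F (0, 1)
  have hFM : ∀ h r, F (h, r) = M h + r * c := by
    intro h r
    have : ((h, r) : C(Y, ℝ) × ℝ) = (h, 0) + r • (0, 1) := by simp
    rw [this, map_add, map_smul]
    rfl
  have key : ∀ e ∈ K, ∀ h : C(Y, ℝ), ∀ r : ℝ, (∀ y, h y < (l - G e) y) → r < J e →
      M h + r * c < v * c := by
    intro e he h r h₁ h₂
    have := hF (h, r) ⟨e, he, h₁, h₂⟩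
    rwa [hFM, hFM, map_zero, zero_add] at this
  have hzero : ∀ y, (0 : C(Y, ℝ)) y < (l - G e₀) y := fun y => by simpa using hslater y
  have hJv : J e₀ ≤ v := hv e₀ he₀ fun y => (hslater y).le
  -- The Slater point puts `(0, J e₀ - 1)` in `A`, which rules out a vertical coefficient `c ≤ 0`.
  have hc : 0 < c := by
    have := key e₀ he₀ 0 (J e₀ - 1) hzero (by linarith)
    rw [map_zero, zero_add] at this
    by_contra! hc
    nlinarith
  have hM : ∀ f : C(Y, ℝ), (∀ y, 0 ≤ f y) → 0 ≤ M f := by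
    intro f hf
    by_contra! hneg
    -- `A` is closed under decreasing the first coordinate. This multiple of `f` is the one whose
    -- subtraction raises the functional exactly to `v * c`, against strict separation.
    have hpos : 0 ≤ (v - (J e₀ - 1)) * c / (-M f) :=
      div_nonneg (mul_nonneg (by linarith) hc.le) (by linarith)
    have := key e₀ he₀ (-((v - (J e₀ - 1)) * c / (-M f)) • f) (J e₀ - 1)
      (fun y => lt_of_le_of_lt ?_ (hzero y)) (by linarith)
    · rw [map_smul, smul_eq_mul] at this
      have h₂ : -((v - (J e₀ - 1)) * c / (-M f)) * M f = (v - (J e₀ - 1)) * c := by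
        have := hneg.ne
        field_simp
      rw [h₂] at this
      linarith
    · simpa using mul_nonneg hpos (hf y)
  refine ⟨c⁻¹ • M, fun f hf => mul_nonneg (inv_nonneg.2 hc.le) (hM f hf), fun e he => ?_⟩
  -- `(l - G e, J e)` is only a limit of points of `A`: lower both coordinates by `ε` and let `ε`
  -- tend to zero.
  have h₁ : M (l - G e) + J e * c ≤ v * c := by
    refine le_of_forall_pos_sub_mul_lt (b := M 1 + c) fun ε hε => ?_
    have := key e he (l - G e - ε • 1) (J e - ε) (fun y => by simpa using hε) (by linarith)
    rw [map_sub, map_smul, smul_eq_mul] at this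
    linarith
  rw [LinearMap.smul_apply, smul_eq_mul]
  have h₂ : c * (J e + c⁻¹ * M (l - G e)) ≤ c * v := by
    rw [mul_add, mul_inv_cancel_left₀ hc.ne']
    linarith
  exact le_of_mul_le_mul_left h₂ hc

end Multiplier

/-! ### Integration as a continuous functional -/

section Integral

variable {Y : Type*} [TopologicalSpace Y] [CompactSpace Y] [MeasurableSpace Y]
  [OpensMeasurableSpace Y]

theorem integrable_continuousMap (ν : Measure Y) [IsFiniteMeasure ν] (f : C(Y, ℝ)) :
    Integrable f ν :=
  f.continuous.integrable_of_hasCompactSupport (HasCompactSupport.of_compactSpace f)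

/-- Integration against a finite measure, as a linear functional on `C(Y, ℝ)`. -/
noncomputable def integralLinearMap (ν : Measure Y) [IsFiniteMeasure ν] : C(Y, ℝ) →ₗ[ℝ] ℝ where
  toFun f := ∫ y, f y ∂ν
  map_add' f g := integral_add (integrable_continuousMap ν f) (integrable_continuousMap ν g)
  map_smul' c f := integral_const_mul c f

theorem continuous_integralLinearMap (ν : Measure Y) [IsFiniteMeasure ν] :
    Continuous (integralLinearMap ν) := by
  refine AddMonoidHomClass.continuous_of_bound (integralLinearMap ν) (ν.real Set.univ) fun f => ?_
  rw [mul_comm]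
  exact norm_integral_le_of_norm_le_const (Filter.Eventually.of_forall f.norm_coe_le_norm)

end Integral

variable {n : ℕ} {X S : Set (Vec n)}

/-! ### The closed convex cone of utilities -/

section Cone

theorem convex_utilityCone : Convex ℝ (utilityCone X S) :=
  (convex_convexHull ℝ _).closure

theorem generatedCone_subset_utilityCone :
    generatedCone (feasibleUtilities X S) ⊆ utilityCone X S :=
  (subset_convexHull ℝ _).trans subset_closure

theorem feasibleUtilities_subset_utilityCone : feasibleUtilities X S ⊆ utilityCone X S :=
  fun u hu => generatedCone_subset_utilityCone ⟨1, zero_le_one, u, hu, (one_smul ℝ u).symm⟩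

theorem smul_mem_utilityCone {c : ℝ} (hc : 0 ≤ c) {f : C(X, ℝ)} (hf : f ∈ utilityCone X S) :
    c • f ∈ utilityCone X S := by
  have h₁ : Set.MapsTo (fun g : C(X, ℝ) => c • g)
      (convexHull ℝ (generatedCone (feasibleUtilities X S)))
      (convexHull ℝ (generatedCone (feasibleUtilities X S))) := by
    intro g hg
    have hpre : Convex ℝ ((LinearMap.lsmul ℝ C(X, ℝ) c) ⁻¹'
        (convexHull ℝ (generatedCone (feasibleUtilities X S)))) :=
      (convex_convexHull ℝ _).linear_preimage _
    refine convexHull_min ?_ hpre hg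
    rintro _ ⟨d, hd, u, hu, rfl⟩
    exact subset_convexHull ℝ _ ⟨c * d, mul_nonneg hc hd, u, hu, smul_smul c d u⟩
  exact h₁.closure (by fun_prop) hf

/-- The affine function `x ↦ s · x + a` on `X`. -/
noncomputable def affineUtility (X : Set (Vec n)) (s : Vec n) (a : ℝ) : C(X, ℝ) where
  toFun x := inner ℝ s (x : Vec n) + a
  continuous_toFun := by fun_prop

theorem affineUtility_apply (s : Vec n) (a : ℝ) (x : X) :
    affineUtility X s a x = inner ℝ s (x : Vec n) + a := rfl

theorem affineUtility_mem_feasibleUtilities (hX : Convex ℝ X) {s : Vec n} (hs : s ∈ S) (a : ℝ) :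
    affineUtility X s a ∈ feasibleUtilities X S := by
  refine ⟨?_, fun x => ⟨s, hs, fun y => ?_⟩⟩
  · have h₁ : ConvexOn ℝ X fun x : Vec n => inner ℝ s x + a :=
      ((innerSL ℝ s).toLinearMap.convexOn hX).add_const a
    refine h₁.congr fun x hx => ?_
    exact (Subtype.val_injective.extend_apply (affineUtility X s a) 0 ⟨x, hx⟩).symm
  · rw [affineUtility_apply, affineUtility_apply, inner_sub_right]
    linarith

theorem zero_mem_utilityCone (hX : Convex ℝ X) (hS : S.Nonempty) :
    (0 : C(X, ℝ)) ∈ utilityCone X S := by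
  obtain ⟨s, hs⟩ := hS
  exact generatedCone_subset_utilityCone
    ⟨0, le_rfl, _, affineUtility_mem_feasibleUtilities hX hs 0, (zero_smul ℝ _).symm⟩

/-- The difference of the two integrals is continuous and linear, so the functions where it is
nonnegative form a closed convex cone, and testing on `U(X,S)` suffices. -/
theorem Dominates.integral_le [CompactSpace X] {ν' ν : Measure X} [IsFiniteMeasure ν']
    [IsFiniteMeasure ν] (h : Dominates S ν' ν) {f : C(X, ℝ)} (hf : f ∈ utilityCone X S) :
    ∫ x, f x ∂ν ≤ ∫ x, f x ∂ν' := by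
  let D : C(X, ℝ) →ₗ[ℝ] ℝ := integralLinearMap ν' - integralLinearMap ν
  have hD : Continuous D := by
    change Continuous fun f => integralLinearMap ν' f - integralLinearMap ν f
    exact (continuous_integralLinearMap ν').sub (continuous_integralLinearMap ν)
  have hclosed : IsClosed (D ⁻¹' Set.Ici 0) := isClosed_Ici.preimage hD
  have hconvex : Convex ℝ (D ⁻¹' Set.Ici 0) := (convex_Ici 0).linear_preimage D
  have hsub : utilityCone X S ⊆ D ⁻¹' Set.Ici 0 := by
    refine closure_minimal (convexHull_min ?_ hconvex) hclosed
    rintro _ ⟨c, hc, u, hu, rfl⟩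
    rw [Set.mem_preimage, map_smul]
    exact mul_nonneg hc (sub_nonneg.2 (h u hu))
  exact sub_nonneg.1 (hsub hf)

end Cone

/-! ### Continuity of the cost -/

section SupportGap

theorem bddAbove_inner_image (hS : Bornology.IsBounded S) (z : Vec n) :
    BddAbove ((fun s : Vec n => inner ℝ s z) '' S) := by
  obtain ⟨R, hR⟩ := hS.exists_norm_le
  refine ⟨R * ‖z‖, ?_⟩
  rintro _ ⟨s, hs, rfl⟩
  exact (real_inner_le_norm s z).trans (mul_le_mul_of_nonneg_right (hR s hs) (norm_nonneg z))

theorem inner_sub_le_supportGap (hS : Bornology.IsBounded S) {s : Vec n} (hs : s ∈ S)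
    (x y : Vec n) : inner ℝ s (x - y) ≤ supportGap S x y :=
  le_csSup (bddAbove_inner_image hS _) ⟨s, hs, rfl⟩

/-- If `R` bounds the norms in `S`, a supremum of linear forms with slopes in `S` is `R`-Lipschitz.
-/
theorem continuous_supportGap (hS : Bornology.IsBounded S) (hne : S.Nonempty) {Y : Type*}
    [TopologicalSpace Y] {f g : Y → Vec n} (hf : Continuous f) (hg : Continuous g) :
    Continuous fun y => supportGap S (f y) (g y) := by
  obtain ⟨R, hR⟩ := hS.exists_norm_le
  have hlip : LipschitzWith R.toNNReal
      fun z : Vec n => sSup ((fun s : Vec n => inner ℝ s z) '' S) := by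
    refine LipschitzWith.of_le_add_mul _ fun z w => csSup_le (hne.image _) ?_
    rintro _ ⟨s, hs, rfl⟩
    have h₁ : inner ℝ s w ≤ sSup ((fun s : Vec n => inner ℝ s w) '' S) :=
      le_csSup (bddAbove_inner_image hS w) ⟨s, hs, rfl⟩
    have h₂ : inner ℝ s (z - w) ≤ R.toNNReal * dist z w := by
      rw [dist_eq_norm]
      refine (real_inner_le_norm s _).trans (mul_le_mul_of_nonneg_right ?_ (norm_nonneg _))
      exact (hR s hs).trans (Real.le_coe_toNNReal R)
    rw [inner_sub_right] at h₂
    change inner ℝ s z ≤ _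
    linarith
  exact hlip.continuous.comp (hf.sub hg)

/-- The function `ℓ_S` on `X × X`. -/
noncomputable def supportGapMap (X : Set (Vec n)) (hS : Bornology.IsBounded S)
    (hne : S.Nonempty) : C(X × X, ℝ) where
  toFun p := supportGap S p.1 p.2
  continuous_toFun := continuous_supportGap hS hne (continuous_subtype_val.comp continuous_fst)
    (continuous_subtype_val.comp continuous_snd)

theorem supportGapMap_apply (hS : Bornology.IsBounded S) (hne : S.Nonempty) (p : X × X) :
    supportGapMap X hS hne p = supportGap S p.1 p.2 := rfl

end SupportGap

/-! ### Boundedness of the primal problem, and marginals -/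

instance (μ : SignedMeasure X) : IsFiniteMeasure (posPart μ) :=
  μ.toJordanDecomposition.posPart_finite

instance (μ : SignedMeasure X) : IsFiniteMeasure (negPart μ) :=
  μ.toJordanDecomposition.negPart_finite

theorem posPart_real_univ_eq {μ : SignedMeasure X} (hμ : μ Set.univ = 0) :
    (posPart μ).real Set.univ = (negPart μ).real Set.univ := by
  have h := congrArg (fun ν : SignedMeasure X => ν Set.univ)
    μ.toSignedMeasure_toJordanDecomposition
  simp only [JordanDecomposition.toSignedMeasure, _root_.sub_apply,
    Measure.toSignedMeasure_apply_measurable MeasurableSet.univ, hμ] at h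
  exact sub_eq_zero.1 h

/-- At a minimiser `y₀` of `ψ` the constraint gives `φ ≤ max ℓ_S + ψ y₀`, while `ψ ≥ ψ y₀`. As `μ₊`
and `μ₋` have equal mass, the terms in `ψ y₀` cancel. -/
theorem bddAbove_primalValues [CompactSpace X] (hS : Bornology.IsBounded S) (hne : S.Nonempty)
    {μ : SignedMeasure X} (hμ : μ Set.univ = 0) : BddAbove (primalValues S μ) := by
  rcases isEmpty_or_nonempty X with hX | hX
  · refine ⟨0, ?_⟩
    rintro _ ⟨φ, -, ψ, -, -, rfl⟩
    rw [Measure.eq_zero_of_isEmpty (posPart μ), Measure.eq_zero_of_isEmpty (negPart μ),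
      integral_zero_measure, integral_zero_measure, sub_zero]
  obtain ⟨B, hB⟩ := (isCompact_range (supportGapMap X hS hne).continuous).bddAbove
  refine ⟨(posPart μ).real Set.univ * B, ?_⟩
  rintro _ ⟨φ, -, ψ, -, h, rfl⟩
  obtain ⟨y₀, -, hy₀⟩ := isCompact_univ.exists_isMinOn Set.univ_nonempty ψ.continuous.continuousOn
  have h₁ : ∫ x, φ x ∂(posPart μ) ≤ ∫ _, (B + ψ y₀) ∂(posPart μ) := by
    refine integral_mono (integrable_continuousMap _ φ) (integrable_const _) fun x => ?_
    have h₁ : supportGap S x y₀ ≤ B := hB ⟨(x, y₀), supportGapMap_apply hS hne _⟩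
    have h₂ := h x y₀
    change φ x ≤ B + ψ y₀
    linarith
  have h₂ : ∫ _, ψ y₀ ∂(negPart μ) ≤ ∫ x, ψ x ∂(negPart μ) :=
    integral_mono (integrable_const _) (integrable_continuousMap _ ψ)
      fun x => hy₀ (Set.mem_univ x)
  rw [integral_const, smul_eq_mul] at h₁ h₂
  rw [← posPart_real_univ_eq hμ] at h₂
  linarith

theorem integral_fst_eq (γ : Measure (X × X)) (f : C(X, ℝ)) :
    ∫ x, f x ∂γ.fst = ∫ p, f p.1 ∂γ :=
  integral_map measurable_fst.aemeasurable f.continuous.aestronglyMeasurable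

theorem integral_snd_eq (γ : Measure (X × X)) (f : C(X, ℝ)) :
    ∫ x, f x ∂γ.snd = ∫ p, f p.2 ∂γ :=
  integral_map measurable_snd.aemeasurable f.continuous.aestronglyMeasurable

/-- The linear map `(φ, ψ) ↦ ((x, y) ↦ φ x - ψ y)`. -/
def differenceMap (X : Set (Vec n)) : C(X, ℝ) × C(X, ℝ) →ₗ[ℝ] C(X × X, ℝ) where
  toFun e := e.1.comp ⟨Prod.fst, continuous_fst⟩ - e.2.comp ⟨Prod.snd, continuous_snd⟩
  map_add' e e' := by
    ext p
    simp only [Prod.fst_add, Prod.snd_add, ContinuousMap.sub_apply, ContinuousMap.comp_apply,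
      ContinuousMap.add_apply]
    ring
  map_smul' c e := by
    ext p
    simp only [Prod.smul_fst, Prod.smul_snd, ContinuousMap.sub_apply, ContinuousMap.comp_apply,
      ContinuousMap.smul_apply, smul_eq_mul, RingHom.id_apply]
    ring

theorem differenceMap_apply (e : C(X, ℝ) × C(X, ℝ)) (p : X × X) :
    differenceMap X e p = e.1 p.1 - e.2 p.2 := rfl

theorem integral_differenceMap [CompactSpace X] (γ : Measure (X × X)) [IsFiniteMeasure γ]
    (e : C(X, ℝ) × C(X, ℝ)) :
    ∫ p, differenceMap X e p ∂γ = ∫ x, e.1 x ∂γ.fst - ∫ x, e.2 x ∂γ.snd := by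
  rw [integral_fst_eq, integral_snd_eq]
  exact integral_sub
    (integrable_continuousMap γ (e.1.comp ⟨Prod.fst, continuous_fst⟩))
    (integrable_continuousMap γ (e.2.comp ⟨Prod.snd, continuous_snd⟩))

theorem nonpos_of_forall_nonneg_mul_le {a b : ℝ} (h : ∀ t : ℝ, 0 ≤ t → t * a ≤ b) : a ≤ 0 := by
  by_contra! ha
  have h₁ := h ((|b| + 1) / a) (by positivity)
  rw [div_mul_cancel₀ _ ha.ne'] at h₁
  linarith [le_abs_self b]

end RestrictedAuction

/-! ### Strong duality -/

open RestrictedAuction in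
theorem mainTheorem3 {n : ℕ} (X S : Set (RestrictedAuction.Vec n))
    (hXcompact : IsCompact X) (hXconvex : Convex ℝ X)
    (hSclosed : IsClosed S) (hSbounded : Bornology.IsBounded S) (hSnonempty : S.Nonempty)
    (μ : MeasureTheory.SignedMeasure X) (hμ : μ Set.univ = 0) :
    ∃ v : ℝ, IsLUB (RestrictedAuction.primalValues S μ) v ∧
      IsLeast (RestrictedAuction.dualValues S μ) v := by
  have : CompactSpace X := isCompact_iff_compactSpace.1 hXcompact
  obtain ⟨s, hs⟩ := id hSnonempty
  have haff : ∀ a : ℝ, affineUtility X s a ∈ utilityCone X S := fun a =>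
    feasibleUtilities_subset_utilityCone (affineUtility_mem_feasibleUtilities hXconvex hs a)
  have hgap : ∀ x y : X, inner ℝ s (x : Vec n) - inner ℝ s (y : Vec n) ≤ supportGap S x y :=
    fun x y => by simpa only [inner_sub_right] using inner_sub_le_supportGap hSbounded hs x y
  have hne : (primalValues S μ).Nonempty := by
    refine ⟨_, affineUtility X s 0, haff 0, affineUtility X s 0, haff 0, fun x y => ?_, rfl⟩
    simpa only [affineUtility_apply, add_zero] using hgap x y
  have hlub := isLUB_csSup hne (bddAbove_primalValues hSbounded hSnonempty hμ)
  set v := sSup (primalValues S μ)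
  obtain ⟨l, hl⟩ : ∃ l : C(X × X, ℝ), ∀ p : X × X, l p = supportGap S p.1 p.2 :=
    ⟨supportGapMap X hSbounded hSnonempty, supportGapMap_apply hSbounded hSnonempty⟩
  let J : C(X, ℝ) × C(X, ℝ) →ₗ[ℝ] ℝ :=
    (integralLinearMap (posPart μ)).comp (LinearMap.fst ℝ _ _) -
      (integralLinearMap (negPart μ)).comp (LinearMap.snd ℝ _ _)
  have hJ : ∀ e, J e = ∫ x, e.1 x ∂(posPart μ) - ∫ x, e.2 x ∂(negPart μ) := fun _ => rfl
  obtain ⟨L, hLpos, hL⟩ := exists_lagrange_multiplier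
    (convex_utilityCone (X := X) (S := S) |>.prod (convex_utilityCone (X := X) (S := S)))
    -- Lowering `φ` by `1` makes the constraint strict everywhere.
    (differenceMap X) J l v (e₀ := (affineUtility X s (-1), affineUtility X s 0))
    ⟨haff _, haff _⟩
    (fun p => by
      have : inner ℝ s (p.1 : Vec n) - inner ℝ s (p.2 : Vec n) ≤ l p := hl p ▸ hgap p.1 p.2
      rw [differenceMap_apply, affineUtility_apply, affineUtility_apply]
      linarith)
    (fun e he h => hlub.1 ⟨e.1, he.1, e.2, he.2, fun x y => hl (x, y) ▸ h (x, y), hJ e⟩)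
  obtain ⟨γ, hγ, hγL⟩ := exists_measure_integral_eq L hLpos
  have hzero := zero_mem_utilityCone hXconvex hSnonempty
  have hmult : ∀ e ∈ utilityCone X S ×ˢ utilityCone X S,
      J e ≤ ∫ x, e.1 x ∂γ.fst - ∫ x, e.2 x ∂γ.snd := by
    intro e he
    rw [← integral_differenceMap, hγL, ← sub_nonpos]
    -- Along the ray `t • e` the multiplier inequality reads `t * (J e - L (G e)) ≤ v - L l` with `G
    -- = differenceMap X`; a bound uniform in `t ≥ 0` forces a nonpositive slope.
    refine nonpos_of_forall_nonneg_mul_le (b := v - L l) fun t ht => ?_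
    have := hL (t • e) ⟨smul_mem_utilityCone ht he.1, smul_mem_utilityCone ht he.2⟩
    rw [map_smul, map_sub, map_smul, map_smul, smul_eq_mul, smul_eq_mul] at this
    linarith
  have hdom₁ : Dominates S γ.fst (posPart μ) := fun u hu => by
    simpa [hJ] using hmult (u, 0) ⟨feasibleUtilities_subset_utilityCone hu, hzero⟩
  have hdom₂ : Dominates S (negPart μ) γ.snd := fun u hu => by
    simpa [hJ] using hmult (0, u) ⟨hzero, feasibleUtilities_subset_utilityCone hu⟩
  -- Weak duality: dominance moves the integrals of `φ` and `ψ` to the marginals of `κ`, where the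
  -- pointwise constraint is integrated.
  have hlower : v ∈ lowerBounds (dualValues S μ) := by
    rintro _ ⟨κ, hκ, h₁, h₂, rfl⟩
    refine hlub.2 ?_
    rintro _ ⟨φ, hφ, ψ, hψ, h, rfl⟩
    have h₃ := h₁.integral_le hφ
    have h₄ := h₂.integral_le hψ
    have h₅ : ∫ p, differenceMap X (φ, ψ) p ∂κ ≤ ∫ p, l p ∂κ :=
      integral_mono (integrable_continuousMap κ _) (integrable_continuousMap κ l)
        fun p => hl p ▸ h p.1 p.2
    rw [integral_differenceMap] at h₅
    have h₆ : ∫ p, l p ∂κ = ∫ p : X × X, supportGap S p.1 p.2 ∂κ :=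
      integral_congr_ae (Filter.Eventually.of_forall hl)
    dsimp only at h₅
    linarith
  have hmem : ∫ p, l p ∂γ ∈ dualValues S μ := 
    ⟨γ, hγ, hdom₁, hdom₂, integral_congr_ae (Filter.Eventually.of_forall hl)⟩
  -- The multiplier inequality at the zero pair.
  have hle : ∫ p, l p ∂γ ≤ v := by
    have := hL 0 ⟨hzero, hzero⟩
    rwa [map_zero, map_zero, sub_zero, zero_add, ← hγL] at this
  exact ⟨v, hlub, le_antisymm hle (hlower hmem) ▸ hmem, hlower⟩
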